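/- Let $n\in\mathbb N$ and write $M_n=M_n(\mathbb C)$ with matrix units $E_{ij}$. For a unital C*-algebra $C$ let $S(C)$ be the set of states of $C$, i.e. of positive linear functionals $\varphi$ with $\varphi(1)=1$; identify $M_n(C)$ with $M_n\otimes C$ (or $C\otimes M_n$). A map $\Lambda:S(M_n\otimes M_n)\to S(M_n\otimes M_n)$ is called a unitary induced channel in the quantum commuting model if there exist a Hilbert space $H$, a state $\phi\in S(B(H))$, and unitaries $U,V\in M_n(B(H))$ such that, in $M_n\otimes B(H)\otimes M_n$, one has $(U\otimes 1)(1\otimes V)=(1\otimes V)(U\otimes 1)$ and $$\Lambda(\varphi)(g\otimes h)=(\varphi\otimes\phi)\big((U\otimes 1)(1\otimes V)(g\otimes 1\otimes h)(1\otimes V^*)(U^*\otimes 1)\big)$$ for all $\varphi\in S(M_n\otimes M_n)$ and $g,h\in M_n$, where $(\varphi\otimes\phi)(a\otimes x\otimes b)=\varphi(a\otimes b)\,\phi(x)$ and where $U\otimes 1=\sum_{i,j}E_{ij}\otimes u_{ij}\otimes 1$, $1\otimes V=\sum_{k,l}1\otimes v_{kl}\otimes E_{kl}$ for $U=(u_{ij})$,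 $V=(v_{kl})$. The Brown algebra $\mathcal U(n)$ is the universal unital C*-algebra generated by elements $u_{ij}$, $1\le i,j\le n$, subject to the relations which make $(u_{ij})_{i,j}$ a unitary matrix: $$\sum_k u_{ik}u_{lk}^*=\delta_{il}1,\qquad \sum_i u_{ik}^*u_{il}=\delta_{kl}1 .$$ Let $A\otimes_{\max}B$ denote the maximal C*-tensor product. Theorem. For every map $\Lambda:S(M_n\otimes M_n)\to S(M_n\otimes M_n)$ the following conditions are equivalent. (1) $\Lambda$ is a unitary induced channel in the quantum commuting model. (2) There exist unital C*-algebras $A,B$, a state $\tilde\phi\in S(A\otimes_{\max}B)$, and unitaries $U=(\tilde u_{ij})\in M_n(A)$, $V=(\tilde v_{ij})\in M_n(B)$ such that for all $\varphi\in S(M_n\otimes M_n)$ and $g,h\in M_n$ $$\Lambda(\varphi)(g\otimes h)=\sum_{i,j,k,l,p,r,s,t=1}^{n}\varphi\big(E_{ij}gE_{kl}\otimes E_{pr}hE_{st}\big)\,\tilde\phi\big(\tilde u_{ij}\tilde u_{lk}^*\otimes\tilde v_{pr}\tilde v_{ts}^*\big).$$ (3) There exists a state $\phi\in S(\mathcal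 U(n)\otimes_{\max}\mathcal U(n))$ such that for all $\varphi\in S(M_n\otimes M_n)$ and $g,h\in M_n$ $$\Lambda(\varphi)(g\otimes h)=\sum_{i,j,k,l,p,r,s,t=1}^{n}\varphi\big(E_{ij}gE_{kl}\otimes E_{pr}hE_{st}\big)\,\phi\big(u_{ij}u_{lk}^*\otimes v_{pr}v_{ts}^*\big),$$ where $u_{ij}$ and $v_{ij}$ denote the generators of the first and of the second copy of $\mathcal U(n)$. -/

import Mathlib

open scoped TensorProduct ComplexOrder

universe u v

noncomputable section

/-! ### States -/

/-- A state on a unital complex `*`-algebra: a positive unital linear functional.  (On a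
C*-algebra the positive elements are exactly the elements `star a * a`.) -/
structure CStarState (A : Type*) [Ring A] [StarRing A] [Algebra ℂ A] extends A →ₗ[ℂ] ℂ where
  nonneg' : ∀ a : A, 0 ≤ toLinearMap (star a * a)
  map_one' : toLinearMap 1 = 1

instance {A : Type*} [Ring A] [StarRing A] [Algebra ℂ A] :
    CoeFun (CStarState A) (fun _ => A → ℂ) where
  coe φ := φ.toLinearMap

/-! ### C*-seminorms and their completions -/

/-- A C*-seminorm on a complex `*`-algebra: a submultiplicative seminorm satisfying the
C*-identity. -/
structure CStarSeminorm (P : Type*) [Ring P] [StarRing P] [Algebra ℂ P] extends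
    Seminorm ℂ P where
  mul_le' : ∀ x y : P, toFun (x * y) ≤ toFun x * toFun y
  star_mul_self' : ∀ x : P, toFun (star x * x) = toFun x * toFun x

namespace CStarSeminorm

section Basic

variable {P : Type*} [Ring P] [StarRing P] [Algebra ℂ P]

instance : CoeFun (CStarSeminorm P) (fun _ => P → ℝ) where
  coe p := p.toSeminorm

theorem mul_le (p : CStarSeminorm P) (x y : P) : p (x * y) ≤ p x * p y := p.mul_le' x y

theorem star_mul_self (p : CStarSeminorm P) (x : P) : p (star x * x) = p x * p x :=
  p.star_mul_self' x

theorem nonneg (p : CStarSeminorm P) (x : P) : 0 ≤ p x := apply_nonneg p.toSeminorm x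

theorem le_star (p : CStarSeminorm P) (x : P) : p x ≤ p (star x) := by
  rcases (p.nonneg x).eq_or_lt with h | h
  · rw [← h]; exact p.nonneg _
  · have := p.mul_le (star x) x
    rw [p.star_mul_self] at this
    exact le_of_mul_le_mul_right this h

theorem star_eq (p : CStarSeminorm P) (x : P) : p (star x) = p x :=
  le_antisymm (by simpa using p.le_star (star x)) (p.le_star x)

/-- The pointwise supremum of a pointwise bounded family of C*-seminorms. -/
def sup (S : Set (CStarSeminorm P)) (hS : ∀ x : P, ∃ C : ℝ, ∀ p ∈ S, p x ≤ C) :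
    CStarSeminorm P :=
  have bdd : ∀ x : P, BddAbove (Set.range fun p : S => p.1 x) := fun x => by
    obtain ⟨C, hC⟩ := hS x
    exact ⟨C, by rintro _ ⟨p, rfl⟩; exact hC p.1 p.2⟩
  have le : ∀ (x : P) (p : S), p.1 x ≤ ⨆ q : S, q.1 x := fun x p => le_ciSup (bdd x) p
  have nn : ∀ x : P, 0 ≤ ⨆ q : S, q.1 x := fun x => Real.iSup_nonneg fun p => p.1.nonneg x
  { toSeminorm := Seminorm.of (fun x => ⨆ p : S, p.1 x)
      (fun x y => Real.iSup_le
        (fun p => (map_add_le_add p.1.toSeminorm x y).trans (add_le_add (le x p) (le y p)))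
        (add_nonneg (nn x) (nn y)))
      (fun a x => by
        simp only [map_smul_eq_mul]
        rw [Real.mul_iSup_of_nonneg (norm_nonneg a)])
    mul_le' := fun x y => Real.iSup_le
      (fun p => (p.1.mul_le x y).trans
        (mul_le_mul (le x p) (le y p) (p.1.nonneg y) (nn x)))
      (mul_nonneg (nn x) (nn y))
    star_mul_self' := fun x => by
      change (⨆ p : S, p.1 (star x * x)) = (⨆ p : S, p.1 x) * (⨆ p : S, p.1 x)
      apply le_antisymm
      · refine Real.iSup_le (fun p => ?_) (mul_nonneg (nn x) (nn x))
        rw [p.1.star_mul_self]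
        exact mul_le_mul (le x p) (le x p) (p.1.nonneg x) (nn x)
      · rw [← sq, ← Real.le_sqrt (nn x) (nn _)]
        refine Real.iSup_le (fun p => ?_) (Real.sqrt_nonneg _)
        rw [Real.le_sqrt (p.1.nonneg x) (nn _), sq, ← p.1.star_mul_self]
        exact le (star x * x) p }

/-- A copy of `P`, to be equipped with the seminorm `p`. -/
def Pre (_p : CStarSeminorm P) : Type _ := P

end Basic

variable {P : Type*} [Ring P] [StarRing P] [Algebra ℂ P] (p : CStarSeminorm P)

instance : Ring p.Pre := inferInstanceAs (Ring P)
instance : StarRing p.Pre := inferInstanceAs (StarRing P)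
instance : Algebra ℂ p.Pre := inferInstanceAs (Algebra ℂ P)
instance [StarModule ℂ P] : StarModule ℂ p.Pre := inferInstanceAs (StarModule ℂ P)

instance : SeminormedRing p.Pre where
  __ := (inferInstance : Ring p.Pre)
  __ : SeminormedAddCommGroup p.Pre :=
    AddGroupSeminorm.toSeminormedAddCommGroup (E := P) p.toSeminorm.toAddGroupSeminorm
  norm_mul_le := p.mul_le'

theorem norm_pre (x : p.Pre) : ‖x‖ = p.toSeminorm x := rfl

instance : NormedAlgebra ℂ p.Pre where
  norm_smul_le a x := (map_smul_eq_mul p.toSeminorm a x).le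

instance : NormedStarGroup p.Pre where
  norm_star_le x := (p.star_eq x).le

/-- The C*-algebra obtained from `P` by dividing out the kernel of `p` and completing. -/
def Completion : Type _ := UniformSpace.Completion p.Pre

instance : NormedRing p.Completion := inferInstanceAs (NormedRing (UniformSpace.Completion p.Pre))

instance : CompleteSpace p.Completion :=
  inferInstanceAs (CompleteSpace (UniformSpace.Completion p.Pre))

instance : NormedAlgebra ℂ p.Completion where
  __ : Algebra ℂ p.Completion := inferInstanceAs (Algebra ℂ (UniformSpace.Completion p.Pre))
  norm_smul_le := fun a (x : UniformSpace.Completion p.Pre) => norm_smul_le a x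

/-- The canonical map from `P` to the completion. -/
def toCompletion : P →ₐ[ℂ] p.Completion where
  toFun x := ((show p.Pre from x : p.Pre) : UniformSpace.Completion p.Pre)
  map_one' := UniformSpace.Completion.coe_one p.Pre
  map_mul' x y := UniformSpace.Completion.coe_mul (α := p.Pre) x y
  map_zero' := UniformSpace.Completion.coe_zero (α := p.Pre)
  map_add' x y := UniformSpace.Completion.coe_add (α := p.Pre) x y
  commutes' _ := rfl

theorem norm_toCompletion (x : P) : ‖p.toCompletion x‖ = p x :=
  UniformSpace.Completion.norm_coe (E := p.Pre) x

theorem denseRange_toCompletion : DenseRange p.toCompletion :=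
  UniformSpace.Completion.denseRange_coe (α := p.Pre)

instance : Star p.Completion where
  star := UniformSpace.Completion.map (star : p.Pre → p.Pre)

theorem continuous_star' : Continuous (star : p.Completion → p.Completion) :=
  UniformSpace.Completion.continuous_map

theorem toCompletion_star (x : P) : p.toCompletion (star x) = star (p.toCompletion x) :=
  (UniformSpace.Completion.map_coe (α := p.Pre)
    (show UniformContinuous (star : p.Pre → p.Pre) from
      (starNormedAddGroupHom (E := p.Pre)).uniformContinuous) x).symm

theorem completion_induction {q : p.Completion → Prop} (x : p.Completion)
    (hc : IsClosed {x | q x}) (h : ∀ a : P, q (p.toCompletion a)) : q x :=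
  UniformSpace.Completion.induction_on (α := p.Pre) x hc h

theorem completion_induction₂ {q : p.Completion → p.Completion → Prop} (x y : p.Completion)
    (hc : IsClosed {x : p.Completion × p.Completion | q x.1 x.2})
    (h : ∀ a b : P, q (p.toCompletion a) (p.toCompletion b)) : q x y :=
  UniformSpace.Completion.induction_on₂ (α := p.Pre) (β := p.Pre) x y hc h

instance : ContinuousStar p.Completion := ⟨p.continuous_star'⟩

instance : StarRing p.Completion where
  star_involutive x := by
    refine p.completion_induction (q := fun x => star (star x) = x) x
      (isClosed_eq (by fun_prop) (by fun_prop)) fun a => ?_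
    rw [← toCompletion_star, ← toCompletion_star, star_star]
  star_mul x y := by
    refine p.completion_induction₂ (q := fun x y => star (x * y) = star y * star x) x y
      (isClosed_eq (by fun_prop) (by fun_prop)) fun a b => ?_
    rw [← map_mul, ← toCompletion_star, ← toCompletion_star, ← toCompletion_star, star_mul, map_mul]
  star_add x y := by
    refine p.completion_induction₂ (q := fun x y => star (x + y) = star x + star y) x y
      (isClosed_eq (by fun_prop) (by fun_prop)) fun a b => ?_
    rw [← map_add, ← toCompletion_star, ← toCompletion_star, ← toCompletion_star, star_add, map_add]

instance : CStarRing p.Completion where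
  norm_mul_self_le x := by
    refine p.completion_induction (q := fun x => ‖x‖ * ‖x‖ ≤ ‖star x * x‖) x
      (isClosed_le (by fun_prop) (by fun_prop)) fun a => ?_
    rw [← toCompletion_star, ← map_mul, norm_toCompletion, norm_toCompletion, star_mul_self]

instance [StarModule ℂ P] : StarModule ℂ p.Completion where
  star_smul c x := by
    have h (d : ℂ) : Continuous fun x : p.Completion => d • x := continuous_const_smul d
    refine p.completion_induction (q := fun x => star (c • x) = star c • star x) x
      (isClosed_eq (p.continuous_star'.comp (h c)) ((h (star c)).comp p.continuous_star'))
      fun a => ?_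
    rw [← map_smul, ← toCompletion_star, ← toCompletion_star, star_smul, map_smul]

instance [StarModule ℂ P] : CStarAlgebra p.Completion where

/-- The canonical map to the completion, as a `*`-homomorphism. -/
def toCompletionStar : P →⋆ₐ[ℂ] p.Completion where
  __ := p.toCompletion
  map_star' := p.toCompletion_star

end CStarSeminorm

/-! ### The maximal tensor product -/

section MaxTensor

variable (A : Type*) (B : Type*) [CStarAlgebra A] [CStarAlgebra B]

theorem CStarSeminorm.tensor_bdd (x : A ⊗[ℂ] B) :
    ∃ C : ℝ, ∀ p ∈ (Set.univ : Set (CStarSeminorm (A ⊗[ℂ] B))), p x ≤ C := by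
  induction x using TensorProduct.induction_on with
  | zero => exact ⟨0, fun p _ => (map_zero p.toSeminorm).le⟩
  | add x y hx hy =>
    obtain ⟨C, hC⟩ := hx
    obtain ⟨D, hD⟩ := hy
    exact ⟨C + D, fun p h =>
      (map_add_le_add p.toSeminorm x y).trans (add_le_add (hC p h) (hD p h))⟩
  | tmul a b =>
    refine ⟨‖a‖ * ‖b‖, fun p _ => ?_⟩
    let f : A →⋆ₐ[ℂ] p.Completion :=
      { (p.toCompletion.comp Algebra.TensorProduct.includeLeft : A →ₐ[ℂ] p.Completion) with
        map_star' := fun a => by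
          change p.toCompletion (star a ⊗ₜ 1) = star (p.toCompletion (a ⊗ₜ 1))
          rw [← p.toCompletion_star, TensorProduct.star_tmul, star_one] }
    let g : B →⋆ₐ[ℂ] p.Completion :=
      { (p.toCompletion.comp Algebra.TensorProduct.includeRight : B →ₐ[ℂ] p.Completion) with
        map_star' := fun b => by
          change p.toCompletion (1 ⊗ₜ star b) = star (p.toCompletion (1 ⊗ₜ b))
          rw [← p.toCompletion_star, TensorProduct.star_tmul, star_one] }
    have ha : p (a ⊗ₜ 1) ≤ ‖a‖ := by
      rw [← p.norm_toCompletion]; exact NonUnitalStarAlgHom.norm_apply_le f a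
    have hb : p (1 ⊗ₜ b) ≤ ‖b‖ := by
      rw [← p.norm_toCompletion]; exact NonUnitalStarAlgHom.norm_apply_le g b
    calc p (a ⊗ₜ b) = p ((a ⊗ₜ 1) * (1 ⊗ₜ b)) := by simp
      _ ≤ p (a ⊗ₜ 1) * p (1 ⊗ₜ b) := p.mul_le _ _
      _ ≤ _ := mul_le_mul ha hb (p.nonneg _) (norm_nonneg a)

/-- The maximal C*-norm on `A ⊗ B`: the largest C*-seminorm on the algebraic tensor product. -/
def maxCStarSeminorm : CStarSeminorm (A ⊗[ℂ] B) :=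
  CStarSeminorm.sup Set.univ (CStarSeminorm.tensor_bdd A B)

/-- The maximal tensor product `A ⊗_max B` of unital C*-algebras: the completion of the algebraic
tensor product in the maximal C*-norm. -/
abbrev MaxTensor : Type _ := (maxCStarSeminorm A B).Completion

variable {A B}

/-- The elementary tensor `a ⊗ b` in `A ⊗_max B`. -/
def MaxTensor.tmul (a : A) (b : B) : MaxTensor A B :=
  (maxCStarSeminorm A B).toCompletion (a ⊗ₜ[ℂ] b)

end MaxTensor

/-! ### The Brown algebra -/

/-- The free unital complex `*`-algebra on a set `X`, i.e. the algebra of noncommutative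
polynomials in the letters `x` (`Sum.inl x`) and their formal adjoints `x*` (`Sum.inr x`). -/
def FreeStarAlgebra (X : Type*) : Type _ := FreeAlgebra ℂ (X ⊕ X)

namespace FreeStarAlgebra

variable {X : Type*}

instance : Ring (FreeStarAlgebra X) := inferInstanceAs (Ring (FreeAlgebra ℂ (X ⊕ X)))
instance : Algebra ℂ (FreeStarAlgebra X) := inferInstanceAs (Algebra ℂ (FreeAlgebra ℂ (X ⊕ X)))

/-- A letter, or the formal adjoint of a letter. -/
def letter (y : X ⊕ X) : FreeStarAlgebra X := FreeAlgebra.ι ℂ y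

/-- The generator `x`. -/
def of (x : X) : FreeStarAlgebra X := letter (Sum.inl x)

theorem induction {q : FreeStarAlgebra X → Prop} (hc : ∀ c : ℂ, q (algebraMap ℂ _ c))
    (hl : ∀ y, q (letter y)) (hm : ∀ a b, q a → q b → q (a * b))
    (ha : ∀ a b, q a → q b → q (a + b)) (a : FreeStarAlgebra X) : q a :=
  FreeAlgebra.induction (R := ℂ) (X := X ⊕ X) (motive := q) hc hl hm ha a

/-- The conjugate-linear antiautomorphism which exchanges each letter with its formal adjoint. -/
def starAux : FreeStarAlgebra X →+* (FreeStarAlgebra X)ᵐᵒᵖ :=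
  letI : Algebra ℂ (FreeStarAlgebra X)ᵐᵒᵖ :=
    ((algebraMap ℂ (FreeStarAlgebra X)ᵐᵒᵖ).comp (starRingEnd ℂ)).toAlgebra'
      (fun c x => Algebra.commutes (starRingEnd ℂ c) x)
  (FreeAlgebra.lift ℂ (fun y : X ⊕ X => MulOpposite.op (letter y.swap))).toRingHom

theorem starAux_algebraMap (c : ℂ) :
    starAux (algebraMap ℂ (FreeStarAlgebra X) c) =
      MulOpposite.op (algebraMap ℂ _ (starRingEnd ℂ c)) := by
  let _ : Algebra ℂ (FreeStarAlgebra X)ᵐᵒᵖ :=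
    ((algebraMap ℂ (FreeStarAlgebra X)ᵐᵒᵖ).comp (starRingEnd ℂ)).toAlgebra'
      (fun c x => Algebra.commutes (starRingEnd ℂ c) x)
  exact (FreeAlgebra.lift ℂ (fun y : X ⊕ X => MulOpposite.op (letter y.swap))).commutes c

theorem starAux_letter (y : X ⊕ X) :
    starAux (letter y) = MulOpposite.op (letter y.swap) := by
  let _ : Algebra ℂ (FreeStarAlgebra X)ᵐᵒᵖ :=
    ((algebraMap ℂ (FreeStarAlgebra X)ᵐᵒᵖ).comp (starRingEnd ℂ)).toAlgebra'
      (fun c x => Algebra.commutes (starRingEnd ℂ c) x)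
  exact FreeAlgebra.lift_ι_apply (fun y : X ⊕ X => MulOpposite.op (letter y.swap)) y

instance : StarRing (FreeStarAlgebra X) where
  star a := (starAux a).unop
  star_involutive a := by
    change (starAux (starAux a).unop).unop = a
    induction a using induction with
    | hc c => simp [starAux_algebraMap]
    | hl y => simp [starAux_letter]
    | hm a b ha hb => simp [ha, hb]
    | ha a b ha hb => simp [ha, hb]
  star_mul a b := by
    change (starAux (a * b)).unop = (starAux b).unop * (starAux a).unop
    simp
  star_add a b := by
    change (starAux (a + b)).unop = (starAux a).unop + (starAux b).unop
    simp

theorem star_algebraMap (c : ℂ) :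
    star (algebraMap ℂ (FreeStarAlgebra X) c) = algebraMap ℂ _ (star c) := by
  change (starAux _).unop = _
  rw [starAux_algebraMap]; rfl

theorem star_letter (y : X ⊕ X) : star (letter y) = letter y.swap := by
  change (starAux _).unop = _
  rw [starAux_letter]; rfl

instance : StarModule ℂ (FreeStarAlgebra X) where
  star_smul c a := by
    rw [Algebra.smul_def, star_mul, star_algebraMap, Algebra.smul_def, Algebra.commutes]

end FreeStarAlgebra

namespace Brown

variable (n : ℕ)

/-- The free generator which becomes the entry `u i j`. -/
def gen {n : ℕ} (i j : Fin n) : FreeStarAlgebra (Fin n × Fin n) := FreeStarAlgebra.of (i, j)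

/-- The C*-seminorms on the free `*`-algebra on `u i j` (`i, j < n`) in which the relations
`∑ k, u i k * (u l k)* = δ i l` and `∑ i, (u i k)* * u i l = δ k l` hold. -/
def admissible : Set (CStarSeminorm (FreeStarAlgebra (Fin n × Fin n))) :=
  {p | (∀ i l : Fin n,
          p ((∑ k, gen i k * star (gen l k)) - if i = l then 1 else 0) = 0) ∧
       (∀ k l : Fin n,
          p ((∑ i, star (gen i k) * gen i l) - if k = l then 1 else 0) = 0)}

theorem gen_le_one {p : CStarSeminorm (FreeStarAlgebra (Fin n × Fin n))}
    (hp : p ∈ admissible n) (i j : Fin n) : p (gen i j) ≤ 1 := by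
  let _ : PartialOrder p.Completion := CStarAlgebra.spectralOrder _
  have : StarOrderedRing p.Completion := CStarAlgebra.spectralOrderedRing _
  let U : Fin n → p.Completion := fun k => p.toCompletion (gen i k)
  have h1 : ∑ k, U k * star (U k) = 1 := by
    have h := hp.1 i i
    rw [← p.norm_toCompletion, norm_eq_zero, if_pos rfl, map_sub, map_one, sub_eq_zero,
      map_sum] at h
    rw [← h]
    refine Finset.sum_congr rfl fun k _ => ?_
    rw [map_mul, p.toCompletion_star]
  have h2 : U j * star (U j) ≤ 1 := by
    rw [← h1]
    exact Finset.single_le_sum (f := fun k => U k * star (U k))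
      (fun k _ => mul_star_self_nonneg (U k)) (Finset.mem_univ j)
  have h3 : ‖U j * star (U j)‖ ≤ ‖(1 : p.Completion)‖ :=
    CStarAlgebra.norm_le_norm_of_nonneg_of_le (mul_star_self_nonneg (U j)) h2
  have h4 : ‖(1 : p.Completion)‖ ≤ 1 := by
    rcases subsingleton_or_nontrivial p.Completion with _ | _
    · simp [Subsingleton.elim (1 : p.Completion) 0]
    · rw [CStarRing.norm_one]
  rw [CStarRing.norm_self_mul_star] at h3
  rw [← p.norm_toCompletion]
  change ‖U j‖ ≤ 1
  nlinarith [norm_nonneg (U j)]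

theorem admissible_bdd (x : FreeStarAlgebra (Fin n × Fin n)) :
    ∃ C : ℝ, ∀ p ∈ admissible n, p x ≤ C := by
  induction x using FreeStarAlgebra.induction with
  | hc c =>
    refine ⟨‖c‖, fun p _ => ?_⟩
    rw [Algebra.algebraMap_eq_smul_one, map_smul_eq_mul p.toSeminorm]
    have h : p 1 * p 1 = p 1 := by simpa using (p.star_mul_self 1).symm
    have h' : p 1 ≤ 1 := by nlinarith [p.nonneg 1]
    exact mul_le_of_le_one_right (norm_nonneg c) h'
  | hl y =>
    refine ⟨1, fun p hp => ?_⟩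
    rcases y with ⟨i, j⟩ | ⟨i, j⟩
    · exact gen_le_one n hp i j
    · have := gen_le_one n hp i j
      rwa [← p.star_eq, gen, FreeStarAlgebra.of, FreeStarAlgebra.star_letter] at this
  | hm a b ha hb =>
    obtain ⟨C, hC⟩ := ha
    obtain ⟨D, hD⟩ := hb
    exact ⟨C * D, fun p h => (p.mul_le a b).trans
      (mul_le_mul (hC p h) (hD p h) (p.nonneg b) ((p.nonneg a).trans (hC p h)))⟩
  | ha a b ha hb =>
    obtain ⟨C, hC⟩ := ha
    obtain ⟨D, hD⟩ := hb
    exact ⟨C + D, fun p h =>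
      (map_add_le_add p.toSeminorm a b).trans (add_le_add (hC p h) (hD p h))⟩

end Brown

/-- The Brown algebra `𝒰(n)`: the universal unital C*-algebra generated by elements `u i j`
(`i, j < n`) subject to the relations making `(u i j)` a unitary matrix.  It is the completion of
the free `*`-algebra in the largest C*-seminorm compatible with the relations. -/
abbrev Brown (n : ℕ) : Type :=
  (CStarSeminorm.sup (Brown.admissible n) (Brown.admissible_bdd n)).Completion

/-- The matrix `(u i j)` of generators of the Brown algebra. -/
def Brown.u (n : ℕ) : Matrix (Fin n) (Fin n) (Brown n) :=
  fun i j => CStarSeminorm.toCompletion _ (Brown.gen i j)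

/-! ### Unitary induced channels -/

/-- The matrix algebra `M_n(ℂ)`. -/
abbrev Mat (n : ℕ) : Type := Matrix (Fin n) (Fin n) ℂ

/-- The matrix unit `E_{ij}`. -/
abbrev matUnit {n : ℕ} (i j : Fin n) : Mat n := Matrix.single i j 1

section Legs

/-- The algebra `A' ⊗ X ⊗ B'`. -/
abbrev Triple (A' X B' : Type*) [Ring A'] [Algebra ℂ A'] [Ring X] [Algebra ℂ X]
    [Ring B'] [Algebra ℂ B'] : Type _ :=
  A' ⊗[ℂ] (X ⊗[ℂ] B')

/-- The elementary tensor `a ⊗ x ⊗ b`. -/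
def Triple.tmul {A' X B' : Type*} [Ring A'] [Algebra ℂ A'] [Ring X] [Algebra ℂ X]
    [Ring B'] [Algebra ℂ B'] (a : A') (x : X) (b : B') : Triple A' X B' :=
  a ⊗ₜ[ℂ] (x ⊗ₜ[ℂ] b)

theorem Triple.tmul_mul_tmul {A' X B' : Type*} [Ring A'] [Algebra ℂ A'] [Ring X] [Algebra ℂ X]
    [Ring B'] [Algebra ℂ B'] (a a' : A') (x x' : X) (b b' : B') :
    Triple.tmul a x b * Triple.tmul a' x' b' = Triple.tmul (a * a') (x * x') (b * b') := by
  simp [Triple.tmul]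

/-- The functional `ω ⊗ φ` on `A' ⊗ X ⊗ B'`, where `ω` is a functional on `A' ⊗ B'` and `φ` one
on `X`; it maps `a ⊗ x ⊗ b` to `ω (a ⊗ b) * φ x`. -/
def prodFunctional {A' X B' : Type*} [Ring A'] [Algebra ℂ A'] [Ring X] [Algebra ℂ X]
    [Ring B'] [Algebra ℂ B'] (ω : A' ⊗[ℂ] B' →ₗ[ℂ] ℂ) (φ : X →ₗ[ℂ] ℂ) :
    Triple A' X B' →ₗ[ℂ] ℂ :=
  LinearMap.mul' ℂ ℂ ∘ₗ TensorProduct.map φ ω ∘ₗ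
    (TensorProduct.leftComm ℂ A' X B').toLinearMap

theorem prodFunctional_tmul {A' X B' : Type*} [Ring A'] [Algebra ℂ A'] [Ring X] [Algebra ℂ X]
    [Ring B'] [Algebra ℂ B'] (ω : A' ⊗[ℂ] B' →ₗ[ℂ] ℂ) (φ : X →ₗ[ℂ] ℂ) (a : A') (x : X) (b : B') :
    prodFunctional ω φ (Triple.tmul a x b) = ω (a ⊗ₜ b) * φ x := by
  simp [prodFunctional, Triple.tmul, mul_comm]

variable {n : ℕ} {X : Type*} [Ring X] [Algebra ℂ X]

/-- `U ⊗ 1_{B'} = ∑ E_{ij} ⊗ u_{ij} ⊗ 1` in `A' ⊗ X ⊗ B'`. -/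
def legA (U : Matrix (Fin n) (Fin n) X) : Triple (Mat n) X (Mat n) :=
  ∑ i, ∑ j, Triple.tmul (matUnit i j) (U i j) 1

/-- `1_{A'} ⊗ V = ∑ 1 ⊗ v_{kl} ⊗ E_{kl}` in `A' ⊗ X ⊗ B'`. -/
def legB (V : Matrix (Fin n) (Fin n) X) : Triple (Mat n) X (Mat n) :=
  ∑ k, ∑ l, Triple.tmul 1 (V k l) (matUnit k l)

end Legs

/-- The set `𝓛_qc(n)` of unitary induced channels in the quantum commuting model. -/
def qcChannels (n : ℕ) :
    Set (CStarState (Mat n ⊗[ℂ] Mat n) → CStarState (Mat n ⊗[ℂ] Mat n)) :=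
  {Λ | ∃ (H : Type u) (_ : NormedAddCommGroup H) (_ : InnerProductSpace ℂ H)
      (_ : CompleteSpace H) (φ : CStarState (H →L[ℂ] H))
      (U V : Matrix (Fin n) (Fin n) (H →L[ℂ] H)),
      U ∈ unitary (Matrix (Fin n) (Fin n) (H →L[ℂ] H)) ∧
      V ∈ unitary (Matrix (Fin n) (Fin n) (H →L[ℂ] H)) ∧
      legA U * legB V = legB V * legA U ∧
      ∀ (ω : CStarState (Mat n ⊗[ℂ] Mat n)) (g h : Mat n),
        Λ ω (g ⊗ₜ h) =
          prodFunctional ω.toLinearMap φ.toLinearMap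
            (legA U * legB V * Triple.tmul g 1 h * legB (star V) * legA (star U))}

/-- `Λ` is given by the formula
`Λ(ω)(g ⊗ h) = ∑ ω(E_{ij} g E_{kl} ⊗ E_{pr} h E_{st}) φ(u_{ij} u_{lk}* ⊗ v_{pr} v_{ts}*)`. -/
def IsGivenBy {n : ℕ} {A B : Type*} [CStarAlgebra A] [CStarAlgebra B]
    (Λ : CStarState (Mat n ⊗[ℂ] Mat n) → CStarState (Mat n ⊗[ℂ] Mat n))
    (φ : CStarState (MaxTensor A B))
    (U : Matrix (Fin n) (Fin n) A) (V : Matrix (Fin n) (Fin n) B) : Prop :=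
  ∀ (ω : CStarState (Mat n ⊗[ℂ] Mat n)) (g h : Mat n),
    Λ ω (g ⊗ₜ h) =
      ∑ i, ∑ j, ∑ k, ∑ l, ∑ p, ∑ r, ∑ s, ∑ t,
        ω ((matUnit i j * g * matUnit k l) ⊗ₜ (matUnit p r * h * matUnit s t)) *
          φ (MaxTensor.tmul (U i j * star (U l k)) (V p r * star (V t s)))

end

noncomputable section

/-! ### Universal properties -/

/-! All three conditions describe the same data: the numbers `φ (u_ij u_lk* v_pr v_ts*)` attached to
a state and two unitary matrices whose entries commute with each other.

For condition (1), comparing coefficients of `E_ij ⊗ · ⊗ E_kl` turns the commutation of the two legs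
into `[u_ij, v_kl] = 0` (`legA_commute_legB_iff`). Unitarity makes commutation with the entries of
`U` pass to their adjoints (`Matrix.commute_star_of_mem_unitary`), so `u_lk*` can be moved to the
left of the `v`-factors, and the channel takes the form of the eight-fold sum
(`prodFunctional_legs`).

The Brown algebra is universal for unitary matrices, and `⊗_max` is universal for commuting pairs of
`*`-homomorphisms. Hence commuting unitary matrices over any C*-algebra `C` yield a `*`-homomorphism
`𝒰(n) ⊗_max 𝒰(n) → C`, along which states pull back (`Brown.exists_state`). With `C = B(H)` this
gives (1) ⇒ (3), and with `C = A ⊗_max B` it gives (2) ⇒ (3).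

Conversely, (3) is an instance of (2) up to the choice of universe. The GNS representation of a
state on `A ⊗_max B`, restricted to the two factors, gives commuting unitary matrices over `B(H)`,
and thus (1). -/

theorem StarAlgHom.norm_le {A C : Type*} [CStarAlgebra A] [CStarAlgebra C] (f : A →⋆ₐ[ℂ] C)
    (a : A) : ‖f a‖ ≤ ‖a‖ :=
  NonUnitalStarAlgHom.norm_apply_le f a

/-! ### Extending homomorphisms to C*-completions -/

namespace CStarSeminorm

variable {P C : Type*} [Ring P] [StarRing P] [Algebra ℂ P] [CStarAlgebra C]

/-- The C*-seminorm induced by a `*`-homomorphism into a C*-algebra. -/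
def ofHom (f : P →⋆ₐ[ℂ] C) : CStarSeminorm P where
  toSeminorm := (normSeminorm ℂ C).comp f.toAlgHom.toLinearMap
  mul_le' x y := by
    change ‖f (x * y)‖ ≤ ‖f x‖ * ‖f y‖
    rw [map_mul]
    exact norm_mul_le _ _
  star_mul_self' x := by
    change ‖f (star x * x)‖ = ‖f x‖ * ‖f x‖
    rw [map_mul, map_star, CStarRing.norm_star_mul_self]

theorem ofHom_apply (f : P →⋆ₐ[ℂ] C) (x : P) : ofHom f x = ‖f x‖ := rfl

theorem le_sup {S : Set (CStarSeminorm P)} (hS : ∀ x : P, ∃ C : ℝ, ∀ p ∈ S, p x ≤ C)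
    {p : CStarSeminorm P} (hp : p ∈ S) (x : P) : p x ≤ sup S hS x := by
  obtain ⟨C, hC⟩ := hS x
  exact le_ciSup (f := fun q : S => q.1 x) ⟨C, by rintro _ ⟨q, rfl⟩; exact hC q.1 q.2⟩ ⟨p, hp⟩

theorem sup_eq_zero {S : Set (CStarSeminorm P)} (hS : ∀ x : P, ∃ C : ℝ, ∀ p ∈ S, p x ≤ C)
    {x : P} (h : ∀ p ∈ S, p x = 0) : sup S hS x = 0 :=
  le_antisymm (Real.iSup_le (fun q : S => (h q.1 q.2).le) le_rfl) (nonneg _ x)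

variable (p : CStarSeminorm P)

/-- A `*`-homomorphism dominated by a C*-seminorm extends to the completion. -/
def lift (f : P →⋆ₐ[ℂ] C) (hf : ∀ x, ‖f x‖ ≤ p x) : p.Completion →⋆ₐ[ℂ] C :=
  let f' : p.Pre →+* C := f.toAlgHom.toRingHom
  have hc : Continuous f' :=
    AddMonoidHomClass.continuous_of_bound f' 1 fun x => by
      rw [one_mul]
      exact hf x
  let F : p.Completion →+* C := UniformSpace.Completion.extensionHom f' hc
  have hF : ∀ x : P, F (p.toCompletion x) = f x :=
    UniformSpace.Completion.extensionHom_coe f' hc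
  have hFc : Continuous F := UniformSpace.Completion.continuous_extension
  { F with
    commutes' := fun r => by
      change F (algebraMap ℂ p.Completion r) = algebraMap ℂ C r
      rw [← p.toCompletion.commutes r, hF]
      exact f.toAlgHom.commutes r
    map_star' := fun x => by
      change F (star x) = star (F x)
      refine p.completion_induction (q := fun x => F (star x) = star (F x)) x
        (isClosed_eq (hFc.comp p.continuous_star') (continuous_star.comp hFc)) fun a => ?_
      rw [← p.toCompletion_star, hF, hF, map_star] }

theorem lift_toCompletion (f : P →⋆ₐ[ℂ] C) (hf : ∀ x, ‖f x‖ ≤ p x) (x : P) :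
    p.lift f hf (p.toCompletion x) = f x :=
  let f' : p.Pre →+* C := f.toAlgHom.toRingHom
  UniformSpace.Completion.extensionHom_coe f'
    (AddMonoidHomClass.continuous_of_bound f' 1 fun x => by
      rw [one_mul]
      exact hf x) x

end CStarSeminorm

/-! ### The universal property of the maximal tensor product -/

namespace MaxTensor

variable {A B C : Type*} [CStarAlgebra A] [CStarAlgebra B] [CStarAlgebra C]

theorem tmul_mul_tmul (a a' : A) (b b' : B) :
    tmul a b * tmul a' b' = tmul (a * a') (b * b') := by
  rw [tmul, tmul, ← map_mul, Algebra.TensorProduct.tmul_mul_tmul, tmul]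

theorem star_tmul (a : A) (b : B) : star (tmul a b) = tmul (star a) (star b) := by
  rw [tmul, ← CStarSeminorm.toCompletion_star, TensorProduct.star_tmul, tmul]

/-- The canonical `*`-homomorphism `a ↦ a ⊗ 1`. -/
def includeLeft : A →⋆ₐ[ℂ] MaxTensor A B where
  __ := (maxCStarSeminorm A B).toCompletion.comp Algebra.TensorProduct.includeLeft
  map_star' a := by
    change tmul (star a) 1 = star (tmul a 1)
    rw [star_tmul, star_one]

/-- The canonical `*`-homomorphism `b ↦ 1 ⊗ b`. -/
def includeRight : B →⋆ₐ[ℂ] MaxTensor A B where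
  __ := (maxCStarSeminorm A B).toCompletion.comp Algebra.TensorProduct.includeRight
  map_star' b := by
    change tmul 1 (star b) = star (tmul 1 b)
    rw [star_tmul, star_one]

theorem includeLeft_apply (a : A) : includeLeft a = tmul a (1 : B) := rfl

theorem includeRight_apply (b : B) : includeRight b = tmul (1 : A) b := rfl

theorem includeLeft_mul_includeRight (a : A) (b : B) :
    includeLeft a * includeRight b = tmul a b := by
  rw [includeLeft_apply, includeRight_apply, tmul_mul_tmul, mul_one, one_mul]

theorem commute_include (a : A) (b : B) :
    Commute (includeLeft a : MaxTensor A B) (includeRight b) := by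
  rw [Commute, SemiconjBy, includeLeft_mul_includeRight, includeLeft_apply, includeRight_apply,
    tmul_mul_tmul, mul_one, one_mul]

/-- Commuting `*`-homomorphisms on `A` and `B` define one on the algebraic tensor product. -/
def liftAlg (f : A →⋆ₐ[ℂ] C) (g : B →⋆ₐ[ℂ] C) (h : ∀ a b, Commute (f a) (g b)) :
    A ⊗[ℂ] B →⋆ₐ[ℂ] C where
  __ := Algebra.TensorProduct.lift f.toAlgHom g.toAlgHom h
  map_star' x := by
    change Algebra.TensorProduct.lift f.toAlgHom g.toAlgHom h (star x) =
      star (Algebra.TensorProduct.lift f.toAlgHom g.toAlgHom h x)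
    induction x using TensorProduct.induction_on with
    | zero => simp
    | add x y hx hy => rw [star_add, map_add, map_add, star_add, hx, hy]
    | tmul a b =>
      rw [TensorProduct.star_tmul, Algebra.TensorProduct.lift_tmul,
        Algebra.TensorProduct.lift_tmul, star_mul]
      change f (star a) * g (star b) = star (g b) * star (f a)
      -- The adjoint of a product reverses the factors; commutation of the two images restores the
      -- order.
      rw [(h _ _).eq, map_star, map_star]

/-- Commuting `*`-homomorphisms on `A` and `B` define one on `A ⊗_max B`. -/
def lift (f : A →⋆ₐ[ℂ] C) (g : B →⋆ₐ[ℂ] C) (h : ∀ a b, Commute (f a) (g b)) :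
    MaxTensor A B →⋆ₐ[ℂ] C :=
  (maxCStarSeminorm A B).lift (liftAlg f g h) fun x =>
    -- The seminorm induced by the homomorphism is one of those over which the maximal norm is the
    -- supremum.
    CStarSeminorm.le_sup (CStarSeminorm.tensor_bdd A B)
      (Set.mem_univ (CStarSeminorm.ofHom (liftAlg f g h))) x

theorem lift_tmul (f : A →⋆ₐ[ℂ] C) (g : B →⋆ₐ[ℂ] C) (h : ∀ a b, Commute (f a) (g b))
    (a : A) (b : B) : lift f g h (tmul a b) = f a * g b :=
  ((maxCStarSeminorm A B).lift_toCompletion (liftAlg f g h) _ (a ⊗ₜ b)).trans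
    (Algebra.TensorProduct.lift_tmul f.toAlgHom g.toAlgHom h a b)

end MaxTensor

/-! ### The universal property of the free `*`-algebra -/

namespace FreeStarAlgebra

variable {X C : Type*} [Ring C] [StarRing C] [Algebra ℂ C] [StarModule ℂ C]

theorem star_of (x : X) : star (of x) = letter (Sum.inr x) := star_letter _

/-- The universal property of the free `*`-algebra. -/
def lift (c : X → C) : FreeStarAlgebra X →⋆ₐ[ℂ] C :=
  let F : FreeStarAlgebra X →ₐ[ℂ] C := FreeAlgebra.lift ℂ (Sum.elim c fun x => star (c x))
  have hF : ∀ y, F (letter y) = Sum.elim c (fun x => star (c x)) y :=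
    FreeAlgebra.lift_ι_apply (Sum.elim c fun x => star (c x))
  { F with
    map_star' := fun a => by
      change F (star a) = star (F a)
      induction a using induction with
      | hc r => rw [star_algebraMap, AlgHom.commutes, AlgHom.commutes, algebraMap_star_comm]
      | hl y => rcases y with x | x <;> simp [star_letter, hF]
      | hm a b ha hb => rw [star_mul, map_mul, map_mul, star_mul, ha, hb]
      | ha a b ha hb => rw [star_add, map_add, map_add, star_add, ha, hb] }

theorem lift_of (c : X → C) (x : X) : lift c (of x) = c x :=
  FreeAlgebra.lift_ι_apply (Sum.elim c fun x => star (c x)) (Sum.inl x)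

end FreeStarAlgebra

/-- Links unitarity in the matrix ring with the defining relations of the Brown algebra. -/
theorem Matrix.mem_unitary_iff_entries {n : ℕ} {C : Type*} [Ring C] [StarRing C]
    {U : Matrix (Fin n) (Fin n) C} :
    U ∈ unitary (Matrix (Fin n) (Fin n) C) ↔
      (∀ i l, ∑ k, U i k * star (U l k) = if i = l then 1 else 0) ∧
        ∀ k l, ∑ i, star (U i k) * U i l = if k = l then 1 else 0 := by
  rw [Unitary.mem_iff, and_comm, ← Matrix.ext_iff, ← Matrix.ext_iff]
  simp [Matrix.mul_apply, Matrix.one_apply, Matrix.star_apply]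

theorem Matrix.map_mem_unitary {n : ℕ} {C D : Type*} [Ring C] [StarRing C] [Algebra ℂ C]
    [Ring D] [StarRing D] [Algebra ℂ D] (f : C →⋆ₐ[ℂ] D) {U : Matrix (Fin n) (Fin n) C}
    (hU : U ∈ unitary (Matrix (Fin n) (Fin n) C)) :
    U.map f ∈ unitary (Matrix (Fin n) (Fin n) D) := by
  rw [Matrix.mem_unitary_iff_entries] at hU ⊢
  constructor
  · intro i l
    have := congrArg f (hU.1 i l)
    simpa [apply_ite f, map_star] using this
  · intro i l
    have := congrArg f (hU.2 i l)
    simpa [apply_ite f, map_star] using this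

/-! ### The universal property of the Brown algebra -/

namespace Brown

variable {n : ℕ} {C : Type*} [CStarAlgebra C]

theorem u_mem_unitary (n : ℕ) : u n ∈ unitary (Matrix (Fin n) (Fin n) (Brown n)) := by
  rw [Matrix.mem_unitary_iff_entries]
  -- An element killed by every admissible seminorm is killed by their supremum, whose completion is
  -- Hausdorff; so the relations become equalities in `Brown n`.
  have key : ∀ x, (∀ p ∈ admissible n, p x = 0) →
      (CStarSeminorm.sup (admissible n) (admissible_bdd n)).toCompletion x = 0 := fun x hx => by
    rw [← norm_eq_zero, CStarSeminorm.norm_toCompletion, CStarSeminorm.sup_eq_zero _ hx]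
  constructor
  · intro i l
    have := key _ fun p hp => hp.1 i l
    rw [map_sub, sub_eq_zero, map_sum] at this
    simp only [map_mul, CStarSeminorm.toCompletion_star] at this
    refine this.trans ?_
    split_ifs
    · exact map_one _
    · exact map_zero _
  · intro k l
    have := key _ fun p hp => hp.2 k l
    rw [map_sub, sub_eq_zero, map_sum] at this
    simp only [map_mul, CStarSeminorm.toCompletion_star] at this
    refine this.trans ?_
    split_ifs
    · exact map_one _
    · exact map_zero _

/-- The universal property of the Brown algebra. -/
def lift (U : Matrix (Fin n) (Fin n) C) (hU : U ∈ unitary (Matrix (Fin n) (Fin n) C)) :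
    Brown n →⋆ₐ[ℂ] C :=
  CStarSeminorm.lift _ (FreeStarAlgebra.lift fun x : Fin n × Fin n => U x.1 x.2) fun x =>
    CStarSeminorm.le_sup (admissible_bdd n)
      (p := CStarSeminorm.ofHom (FreeStarAlgebra.lift fun x : Fin n × Fin n => U x.1 x.2))
      -- Admissibility: the relations hold exactly for the entries of `U`, so their images have norm
      -- zero.
      (by
        rw [Matrix.mem_unitary_iff_entries] at hU
        constructor
        · intro i l
          simp only [CStarSeminorm.ofHom_apply, gen, map_sub, map_sum, map_mul, map_star,
            FreeStarAlgebra.lift_of, hU.1]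
          split_ifs <;> simp
        · intro k l
          simp only [CStarSeminorm.ofHom_apply, gen, map_sub, map_sum, map_mul, map_star,
            FreeStarAlgebra.lift_of, hU.2]
          split_ifs <;> simp) x

theorem lift_u (U : Matrix (Fin n) (Fin n) C) (hU : U ∈ unitary (Matrix (Fin n) (Fin n) C))
    (i j : Fin n) : lift U hU (u n i j) = U i j :=
  (CStarSeminorm.lift_toCompletion _ _ _ _).trans (FreeStarAlgebra.lift_of _ _)

/-- Elements of a C*-algebra which `*`-commute with the image of the generators commute with the
image of the Brown algebra. -/
theorem commute_of_commute_u (f : Brown n →⋆ₐ[ℂ] C) {c : C}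
    (h : ∀ i j, Commute (f (u n i j)) c) (h' : ∀ i j, Commute (f (star (u n i j))) c)
    (a : Brown n) : Commute (f a) c := by
  have hf : Continuous f := AddMonoidHomClass.continuous_of_bound f 1 fun x => by
    rw [one_mul]
    exact StarAlgHom.norm_le f x
  -- Commuting with `c` is a closed condition stable under sums and products, so letters and their
  -- formal adjoints suffice.
  refine CStarSeminorm.completion_induction _ (q := fun a => f a * c = c * f a) a
    (isClosed_eq (by fun_prop) (by fun_prop)) fun a => ?_
  change Commute _ _
  induction a using FreeStarAlgebra.induction with
  | hc r =>
    rw [AlgHom.commutes, AlgHomClass.commutes]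
    exact Algebra.commutes _ _
  | hl y =>
    rcases y with ⟨i, j⟩ | ⟨i, j⟩
    · exact h i j
    · rw [← FreeStarAlgebra.star_of, CStarSeminorm.toCompletion_star]
      exact h' i j
  | hm a b ha hb =>
    rw [map_mul, map_mul]
    exact ha.mul_left hb
  | ha a b ha hb =>
    rw [map_add, map_add]
    exact ha.add_left hb

end Brown

/-! ### States and the GNS construction -/

namespace CStarState

/-- The pullback of a state along a unital `*`-homomorphism. -/
def comp {A B : Type*} [Ring A] [StarRing A] [Algebra ℂ A] [Ring B] [StarRing B] [Algebra ℂ B]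
    (φ : CStarState B) (f : A →⋆ₐ[ℂ] B) : CStarState A where
  toLinearMap := φ.toLinearMap ∘ₗ f.toAlgHom.toLinearMap
  nonneg' a := by
    change 0 ≤ φ (f (star a * a))
    rw [map_mul, map_star]
    exact φ.nonneg' _
  map_one' := by
    change φ (f 1) = 1
    rw [map_one]
    exact φ.map_one'

theorem comp_apply {A B : Type*} [Ring A] [StarRing A] [Algebra ℂ A] [Ring B] [StarRing B]
    [Algebra ℂ B] (φ : CStarState B) (f : A →⋆ₐ[ℂ] B) (a : A) : φ.comp f a = φ (f a) := rfl

/-- The vector state of a unit vector. -/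
def ofUnitVector {H : Type*} [NormedAddCommGroup H] [InnerProductSpace ℂ H] [CompleteSpace H]
    (x : H) (hx : ‖x‖ = 1) : CStarState (H →L[ℂ] H) where
  toFun T := inner ℂ x (T x)
  map_add' S T := by simp
  map_smul' c T := by simp
  nonneg' T := by
    change 0 ≤ inner ℂ x ((star T * T) x)
    rw [ContinuousLinearMap.star_eq_adjoint, mul_apply_eq_comp,
      ContinuousLinearMap.adjoint_inner_right]
    exact RCLike.nonneg_iff.mpr ⟨inner_self_nonneg, inner_self_im _⟩
  map_one' := by
    change inner ℂ x x = 1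
    rw [inner_self_eq_norm_sq_to_K, hx]
    simp

/-- Every state of a C*-algebra is the pullback of a state along a representation. -/
theorem exists_representation {A : Type u} [CStarAlgebra A] (φ : CStarState A) :
    ∃ (H : Type u) (_ : NormedAddCommGroup H) (_ : InnerProductSpace ℂ H) (_ : CompleteSpace H)
      (π : A →⋆ₐ[ℂ] (H →L[ℂ] H)) (ψ : CStarState (H →L[ℂ] H)), ∀ a, ψ (π a) = φ a := by
  let _ : PartialOrder A := CStarAlgebra.spectralOrder _
  have : StarOrderedRing A := CStarAlgebra.spectralOrderedRing _
  -- In the spectral order the positive elements are exactly the `star y * y`, on which a state is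
  -- nonnegative by definition.
  let f : A →ₚ[ℂ] ℂ := PositiveLinearMap.mk₀ φ.toLinearMap fun x hx => by
    obtain ⟨y, rfl⟩ := CStarAlgebra.nonneg_iff_eq_star_mul_self.mp hx
    exact φ.nonneg' y
  have hf : ∀ a, f a = φ a := fun _ => rfl
  -- The cyclic vector is the class of `1`, so `⟨x, π(a) x⟩ = φ(a)`; for `a = 1` this shows that it
  -- is a unit vector.
  let x : f.GNS := (f.toPreGNS 1 : f.PreGNS)
  have key : ∀ a, inner ℂ x (f.gnsStarAlgHom a x) = φ a := fun a => by
    change inner ℂ x (f.gnsNonUnitalStarAlgHom a x) = φ a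
    rw [PositiveLinearMap.gnsNonUnitalStarAlgHom_apply_coe, UniformSpace.Completion.inner_coe,
      PositiveLinearMap.preGNS_inner_def]
    simp [hf]
  have hx : ‖x‖ = 1 := by
    have h := key 1
    rw [map_one, one_apply_eq_self, inner_self_eq_norm_sq_to_K, φ.map_one'] at h
    have h' : ((‖x‖ ^ 2 : ℝ) : ℂ) = 1 := (Complex.ofReal_pow _ _).trans h
    rwa [Complex.ofReal_eq_one, pow_eq_one_iff_of_nonneg (norm_nonneg x) two_ne_zero] at h'
  exact ⟨f.GNS, inferInstance, inferInstance, inferInstance, f.gnsStarAlgHom,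
    ofUnitVector x hx, key⟩

end CStarState

/-! ### The legs -/

section Legs

variable {n : ℕ} {X : Type*} [Ring X] [Algebra ℂ X]

/-- The coefficient of `E_{ij} ⊗ · ⊗ E_{kl}`. -/
def Triple.entry (i j k l : Fin n) : Triple (Mat n) X (Mat n) →ₗ[ℂ] X :=
  (TensorProduct.lid ℂ X).toLinearMap ∘ₗ
    TensorProduct.map (Matrix.entryLinearMap ℂ ℂ i j)
      ((TensorProduct.rid ℂ X).toLinearMap ∘ₗ
        TensorProduct.map LinearMap.id (Matrix.entryLinearMap ℂ ℂ k l))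

theorem Triple.entry_tmul (i j k l : Fin n) (a : Mat n) (x : X) (b : Mat n) :
    Triple.entry i j k l (Triple.tmul a x b) = a i j • b k l • x := by
  simp [Triple.entry, Triple.tmul, smul_comm (b k l)]

theorem legA_mul_legB (U V : Matrix (Fin n) (Fin n) X) :
    legA U * legB V =
      ∑ i, ∑ j, ∑ k, ∑ l, Triple.tmul (matUnit i j) (U i j * V k l) (matUnit k l) := by
  simp_rw [legA, legB, Finset.sum_mul, Finset.mul_sum, Triple.tmul_mul_tmul, mul_one, one_mul]

theorem legB_mul_legA (U V : Matrix (Fin n) (Fin n) X) :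
    legB V * legA U =
      ∑ i, ∑ j, ∑ k, ∑ l, Triple.tmul (matUnit i j) (V k l * U i j) (matUnit k l) := by
  simp_rw [legA, legB, Finset.mul_sum, Finset.sum_mul, Triple.tmul_mul_tmul, mul_one, one_mul]

/-- This is the linear independence of the `E_ij ⊗ · ⊗ E_kl` over `X`, which allows coefficients to
be compared. -/
theorem Triple.entry_sum (W : Fin n → Fin n → Fin n → Fin n → X) (i j k l : Fin n) :
    Triple.entry i j k l
      (∑ i, ∑ j, ∑ k, ∑ l, Triple.tmul (matUnit i j) (W i j k l) (matUnit k l)) = W i j k l := by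
  simp only [map_sum, Triple.entry_tmul, Matrix.single_apply]
  rw [Finset.sum_eq_single i (by intros; simp_all) (by simp),
    Finset.sum_eq_single j (by intros; simp_all) (by simp),
    Finset.sum_eq_single k (by intros; simp_all) (by simp),
    Finset.sum_eq_single l (by intros; simp_all) (by simp)]
  simp

/-- The legs commute exactly if the entries do. -/
theorem legA_commute_legB_iff {U V : Matrix (Fin n) (Fin n) X} :
    legA U * legB V = legB V * legA U ↔ ∀ i j k l, Commute (U i j) (V k l) := by
  rw [legA_mul_legB, legB_mul_legA]
  constructor
  · intro h i j k l
    have := congrArg (Triple.entry i j k l) h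
    rwa [Triple.entry_sum (fun i j k l => U i j * V k l),
      Triple.entry_sum (fun i j k l => V k l * U i j)] at this
  · intro h
    simp_rw [(h _ _ _ _).eq]

/-- An element commuting with the entries of a unitary matrix commutes with their adjoints. -/
theorem Matrix.commute_star_of_mem_unitary {X : Type*} [Ring X] [StarRing X]
    {U : Matrix (Fin n) (Fin n) X} (hU : U ∈ unitary (Matrix (Fin n) (Fin n) X)) {x : X}
    (h : ∀ i j, Commute (U i j) x)
    (i j : Fin n) : Commute (star (U i j)) x := by
  -- Entrywise commutation says that `U` commutes with the diagonal matrix of `x`. Multiplying by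
  -- `star U` on both sides transfers this to `star U`; a single entry need not be normal, so the
  -- whole matrix is needed.
  have h1 : U * Matrix.scalar (Fin n) x = Matrix.scalar (Fin n) x * U := by
    ext i j
    simpa using (h i j).eq
  have h2 : star U * Matrix.scalar (Fin n) x = Matrix.scalar (Fin n) x * star U := by
    calc star U * Matrix.scalar (Fin n) x
        = star U * (Matrix.scalar (Fin n) x * U) * star U := by
          rw [mul_assoc, mul_assoc, Unitary.mul_star_self_of_mem hU, mul_one]
      _ = star U * U * Matrix.scalar (Fin n) x * star U := by rw [← h1, mul_assoc (star U) U]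
      _ = Matrix.scalar (Fin n) x * star U := by
          rw [Unitary.star_mul_self_of_mem hU, one_mul]
  -- The indices are swapped because the `(j, i)` entry of `star U` is `star (U i j)`.
  have := congrFun (congrFun h2 j) i
  simpa [Matrix.star_apply, Commute, SemiconjBy] using this

theorem Finset.sum_sum_mul_mul_sum_sum {R : Type*} [Semiring R] (a b : Fin n → Fin n → R)
    (x : R) :
    (∑ i, ∑ j, a i j) * x * (∑ k, ∑ l, b k l) = ∑ i, ∑ j, ∑ k, ∑ l, a i j * x * b k l := by
  simp_rw [Finset.sum_mul, Finset.mul_sum]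

/-- The value of a quantum commuting channel in terms of the entries of the unitaries. -/
theorem prodFunctional_legs [StarRing X] {U V : Matrix (Fin n) (Fin n) X}
    (h : ∀ i j k l, Commute (star (U i j)) (V k l))
    (h' : ∀ i j k l, Commute (star (U i j)) (star (V k l)))
    (ω : Mat n ⊗[ℂ] Mat n →ₗ[ℂ] ℂ) (φ : X →ₗ[ℂ] ℂ) (g g' : Mat n) :
    prodFunctional ω φ
        (legA U * legB V * Triple.tmul g 1 g' * legB (star V) * legA (star U)) =
      ∑ i, ∑ j, ∑ k, ∑ l, ∑ p, ∑ r, ∑ s, ∑ t,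
        ω ((matUnit i j * g * matUnit k l) ⊗ₜ (matUnit p r * g' * matUnit s t)) *
          φ (U i j * star (U l k) * (V p r * star (V t s))) := by
  -- Conjugation by the `V`-leg leaves the first tensor factor alone, so it is carried out before
  -- conjugation by the `U`-leg.
  have h1 : legB V * Triple.tmul g 1 g' * legB (star V) = ∑ p, ∑ r, ∑ s, ∑ t,
      Triple.tmul g (V p r * star (V t s)) (matUnit p r * g' * matUnit s t) := by
    simp_rw [legB, Finset.sum_sum_mul_mul_sum_sum, Triple.tmul_mul_tmul, mul_one, one_mul,
      Matrix.star_apply]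
  rw [mul_assoc (legA U), mul_assoc (legA U), h1, legA, legA, Finset.sum_sum_mul_mul_sum_sum]
  simp_rw [Finset.mul_sum, Finset.sum_mul, map_sum, Triple.tmul_mul_tmul, prodFunctional_tmul,
    mul_one, one_mul, Matrix.star_apply]
  -- The middle factor comes out as `u (v v*) u*`; the last `u*` commutes past `v v*`.
  have h2 : ∀ i j k l p r s t, U i j * (V p r * star (V t s)) * star (U l k) =
      U i j * star (U l k) * (V p r * star (V t s)) := fun i j k l p r s t => by
    rw [mul_assoc, mul_assoc (U i j), ((h l k p r).mul_right (h' l k t s)).eq]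
  simp_rw [h2]

end Legs

/-! ### The theorem -/

section Main

variable {n : ℕ}

/-- Commuting unitary matrices over a C*-algebra with a state induce a state on
`𝒰(n) ⊗_max 𝒰(n)`. -/
theorem Brown.exists_state {C : Type*} [CStarAlgebra C] (φ : CStarState C)
    {U V : Matrix (Fin n) (Fin n) C} (hU : U ∈ unitary (Matrix (Fin n) (Fin n) C))
    (hV : V ∈ unitary (Matrix (Fin n) (Fin n) C)) (h : ∀ i j k l, Commute (U i j) (V k l)) :
    ∃ ψ : CStarState (MaxTensor (Brown n) (Brown n)), ∀ i j k l p r s t,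
      ψ (MaxTensor.tmul (Brown.u n i j * star (Brown.u n k l))
        (Brown.u n p r * star (Brown.u n s t))) =
      φ (U i j * star (U k l) * (V p r * star (V s t))) := by
  have h₁ : ∀ i j k l, Commute (star (U i j)) (V k l) := fun i j k l =>
    Matrix.commute_star_of_mem_unitary hU (fun i j => h i j k l) i j
  -- Commutation is extended from generators one variable at a time: to all of the first copy
  -- against a fixed `v_kl`, and then to the second copy against a fixed image of the first.
  have h₂ : ∀ (a : Brown n) (k l), Commute (Brown.lift U hU a) (V k l) := fun a k l =>
    Brown.commute_of_commute_u _ (fun i j => by rw [Brown.lift_u]; exact h i j k l)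
      (fun i j => by rw [map_star, Brown.lift_u]; exact h₁ i j k l) a
  have h₃ : ∀ a b : Brown n, Commute (Brown.lift U hU a) (Brown.lift V hV b) := fun a b =>
    (Brown.commute_of_commute_u (Brown.lift V hV)
      (fun k l => by rw [Brown.lift_u]; exact (h₂ a k l).symm)
      (fun k l => by
        rw [map_star, Brown.lift_u]
        exact Matrix.commute_star_of_mem_unitary hV (fun k l => (h₂ a k l).symm) k l) b).symm
  refine ⟨φ.comp (MaxTensor.lift _ _ h₃), fun i j k l p r s t => ?_⟩
  simp only [CStarState.comp_apply, MaxTensor.lift_tmul, map_mul, map_star, Brown.lift_u]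

variable {Λ : CStarState (Mat n ⊗[ℂ] Mat n) → CStarState (Mat n ⊗[ℂ] Mat n)}

/-- The channel sees `φ` only through the values `φ (u u* v v*)`, which `Brown.exists_state`
reproduces for `C = B(H)`. -/
theorem exists_isGivenBy_brown_of_mem_qcChannels (hΛ : Λ ∈ qcChannels.{u} n) :
    ∃ φ : CStarState (MaxTensor (Brown n) (Brown n)),
      IsGivenBy Λ φ (Brown.u n) (Brown.u n) := by
  obtain ⟨H, _, _, _, φ, U, V, hU, hV, hUV, hΛ⟩ := hΛ
  rw [legA_commute_legB_iff] at hUV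
  obtain ⟨ψ, hψ⟩ := Brown.exists_state φ hU hV hUV
  have h₁ : ∀ i j k l, Commute (star (U i j)) (V k l) := fun i j k l =>
    Matrix.commute_star_of_mem_unitary hU (fun i j => hUV i j k l) i j
  refine ⟨ψ, fun ω g h => ?_⟩
  rw [hΛ, prodFunctional_legs h₁ fun i j k l => (hUV i j k l).star_star]
  simp_rw [hψ]

/-- The entries of `U ⊗ 1` and `1 ⊗ V` commute in `A ⊗_max B`, so `Brown.exists_state` applies to
this algebra and its given state. -/
theorem IsGivenBy.exists_brown {A B : Type*} [CStarAlgebra A] [CStarAlgebra B]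
    {φ : CStarState (MaxTensor A B)}
    {U : Matrix (Fin n) (Fin n) A} {V : Matrix (Fin n) (Fin n) B}
    (hU : U ∈ unitary (Matrix (Fin n) (Fin n) A)) (hV : V ∈ unitary (Matrix (Fin n) (Fin n) B))
    (hΛ : IsGivenBy Λ φ U V) :
    ∃ ψ : CStarState (MaxTensor (Brown n) (Brown n)),
      IsGivenBy Λ ψ (Brown.u n) (Brown.u n) := by
  obtain ⟨ψ, hψ⟩ := Brown.exists_state φ
    (Matrix.map_mem_unitary (MaxTensor.includeLeft (B := B)) hU)
    (Matrix.map_mem_unitary (MaxTensor.includeRight (A := A)) hV)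
    fun i j k l => MaxTensor.commute_include _ _
  refine ⟨ψ, fun ω g h => ?_⟩
  rw [hΛ]
  have key : ∀ i j k l p r s t,
      φ (MaxTensor.tmul (U i j * star (U l k)) (V p r * star (V t s))) =
        ψ (MaxTensor.tmul (Brown.u n i j * star (Brown.u n l k))
          (Brown.u n p r * star (Brown.u n t s))) := fun i j k l p r s t => by
    rw [hψ, ← MaxTensor.includeLeft_mul_includeRight, map_mul MaxTensor.includeLeft,
      map_mul MaxTensor.includeRight, map_star, map_star]
    rfl
  simp_rw [key]

/-- The Brown algebra can be replaced by a copy in any universe. -/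
theorem IsGivenBy.exists_lift {φ : CStarState (MaxTensor (Brown n) (Brown n))}
    (hΛ : IsGivenBy Λ φ (Brown.u n) (Brown.u n)) :
    ∃ (A B : Type v) (_ : CStarAlgebra A) (_ : CStarAlgebra B)
      (φ : CStarState (MaxTensor A B))
      (U : Matrix (Fin n) (Fin n) A) (V : Matrix (Fin n) (Fin n) B),
      U ∈ unitary (Matrix (Fin n) (Fin n) A) ∧ V ∈ unitary (Matrix (Fin n) (Fin n) B) ∧
      IsGivenBy Λ φ U V := by
  -- Functions on a one-point type form a copy of `𝒰(n)` in universe `v`; evaluation at the point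
  -- leads back to the original and transports the state.
  let ev : (PUnit.{v + 1} → Brown n) →⋆ₐ[ℂ] Brown n :=
    Pi.evalStarAlgHom ℂ (fun _ : PUnit.{v + 1} => Brown n) PUnit.unit
  let F : MaxTensor (PUnit.{v + 1} → Brown n) (PUnit.{v + 1} → Brown n) →⋆ₐ[ℂ]
      MaxTensor (Brown n) (Brown n) :=
    MaxTensor.lift (MaxTensor.includeLeft.comp ev) (MaxTensor.includeRight.comp ev)
      fun _ _ => MaxTensor.commute_include _ _
  let U : Matrix (Fin n) (Fin n) (PUnit.{v + 1} → Brown n) := fun i j _ => Brown.u n i j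
  have hU : U ∈ unitary (Matrix (Fin n) (Fin n) (PUnit.{v + 1} → Brown n)) := by
    have := Matrix.mem_unitary_iff_entries.mp (Brown.u_mem_unitary n)
    rw [Matrix.mem_unitary_iff_entries]
    constructor
    · intro i l
      funext x
      simpa [U, apply_ite (fun f : PUnit → Brown n => f x)] using this.1 i l
    · intro k l
      funext x
      simpa [U, apply_ite (fun f : PUnit → Brown n => f x)] using this.2 k l
  refine ⟨PUnit.{v + 1} → Brown n, PUnit.{v + 1} → Brown n, inferInstance, inferInstance,
    φ.comp F, U, U, hU, hU, fun ω g h => ?_⟩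
  have hF : ∀ a b, F (MaxTensor.tmul a b) = MaxTensor.tmul (ev a) (ev b) := fun a b =>
    (MaxTensor.lift_tmul _ _ _ a b).trans (MaxTensor.includeLeft_mul_includeRight _ _)
  rw [hΛ]
  have key : ∀ i j k l p r s t,
      φ (MaxTensor.tmul (Brown.u n i j * star (Brown.u n l k))
          (Brown.u n p r * star (Brown.u n t s))) =
        φ.comp F (MaxTensor.tmul (U i j * star (U l k)) (U p r * star (U t s))) :=
    fun i j k l p r s t => by
      rw [CStarState.comp_apply, hF]
      rfl
  simp_rw [key]

/-- The two factors of `A ⊗_max B` commute, so a representation of it restricts to commuting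
representations of `A` and `B`. The GNS space lies in the universe of `A` and `B`, which is why both
are taken in universe `u`. -/
theorem IsGivenBy.mem_qcChannels {A B : Type u} [CStarAlgebra A] [CStarAlgebra B]
    {φ : CStarState (MaxTensor A B)}
    {U : Matrix (Fin n) (Fin n) A} {V : Matrix (Fin n) (Fin n) B}
    (hU : U ∈ unitary (Matrix (Fin n) (Fin n) A)) (hV : V ∈ unitary (Matrix (Fin n) (Fin n) B))
    (hΛ : IsGivenBy Λ φ U V) : Λ ∈ qcChannels.{u} n := by
  obtain ⟨H, _, _, _, π, ψ, hψ⟩ := φ.exists_representation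
  let f : A →⋆ₐ[ℂ] (H →L[ℂ] H) := π.comp MaxTensor.includeLeft
  let f' : B →⋆ₐ[ℂ] (H →L[ℂ] H) := π.comp MaxTensor.includeRight
  have hff' : ∀ a b, Commute (f a) (f' b) := fun a b => (MaxTensor.commute_include a b).map π
  have hψ' : ∀ a b, ψ (f a * f' b) = φ (MaxTensor.tmul a b) := fun a b => by
    rw [← hψ, ← MaxTensor.includeLeft_mul_includeRight, map_mul π]
    rfl
  refine ⟨H, inferInstance, inferInstance, inferInstance, ψ, U.map f, V.map f',
    Matrix.map_mem_unitary f hU, Matrix.map_mem_unitary f' hV,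
    legA_commute_legB_iff.mpr fun i j k l => hff' _ _, fun ω g h => ?_⟩
  rw [hΛ, prodFunctional_legs]
  · simp_rw [Matrix.map_apply, ← map_star, ← map_mul, hψ']
  · intro i j k l
    rw [Matrix.map_apply, ← map_star]
    exact hff' _ _
  · intro i j k l
    rw [Matrix.map_apply, Matrix.map_apply, ← map_star, ← map_star]
    exact hff' _ _

end Main

end

theorem mainTheorem3 (n : ℕ)
    (Λ : CStarState (Mat n ⊗[ℂ] Mat n) → CStarState (Mat n ⊗[ℂ] Mat n)) :
    List.TFAE
      [Λ ∈ qcChannels.{u} n,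
       ∃ (A B : Type v) (_ : CStarAlgebra A) (_ : CStarAlgebra B)
         (φ : CStarState (MaxTensor A B))
         (U : Matrix (Fin n) (Fin n) A) (V : Matrix (Fin n) (Fin n) B),
         U ∈ unitary (Matrix (Fin n) (Fin n) A) ∧
         V ∈ unitary (Matrix (Fin n) (Fin n) B) ∧
         IsGivenBy Λ φ U V,
       ∃ φ : CStarState (MaxTensor (Brown n) (Brown n)),
         IsGivenBy Λ φ (Brown.u n) (Brown.u n)] := by
  tfae_have 1 → 3 := exists_isGivenBy_brown_of_mem_qcChannels
  tfae_have 2 → 3 := by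
    rintro ⟨A, B, _, _, φ, U, V, hU, hV, hΛ⟩
    exact hΛ.exists_brown hU hV
  tfae_have 3 → 2 := by
    rintro ⟨φ, hΛ⟩
    exact hΛ.exists_lift
  tfae_have 3 → 1 := by
    rintro ⟨φ, hΛ⟩
    -- The Brown algebra is first copied into universe `u`, so that its GNS space is admissible in
    -- `qcChannels.{u}`.
    obtain ⟨A, B, _, _, φ', U, V, hU, hV, hΛ'⟩ := hΛ.exists_lift.{u}
    exact hΛ'.mem_qcChannels hU hV
  tfae_finish
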